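/- Let $X$ be a real Banach space with a Schauder basis $(e_i)_{i\ge1}$ that is unconditional (there is a constant $D$ with $\|\sum_{i=1}^n \epsilon_i c_i e_i\|\le D\|\sum_{i=1}^n c_i e_i\|$ for all $n$, all real $c_i$ and all signs $\epsilon_i\in\{-1,1\}$) and pre-monotone ($\|x-\sum_{i=1}^n e_i^*(x)e_i\|\le\|x\|$ for all $x\in X$ and $n\in\mathbb N$, where $(e_i^*)$ are the coefficient functionals). Suppose that no subspace of $X$ is isomorphic to $\ell_1$. Then $X$ fails the fixed point property for affine nonexpansive mappings if and only if $X$ contains a basic sequence which is not boundedly complete. Here $X$ has the fixed point property for affine nonexpansive mappings if, for every nonempty closed bounded convex set $C\subset X$, every map $T\colon C\to C$ that is nonexpansive ($\|Tx-Ty\|\le\|x-y\|$ for all $x,y\in C$) and affine ($T(\lambda x+(1-\lambda)y)=\lambda Tx+(1-\lambda)Ty$ for all $x,y\in C$ and $\lambda\in[0,1]$) has a fixed point; $X$ fails this property if it does not have it. A sequence $(x_n)$ in $X$ is basic if it is a Schauder basis of its closed linear span, and a basic sequence $(x_n)$ is boundedly complete if, for every real sequence $(a_i)$ with $\sup_N\|\sum_{i=1}^N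 a_i x_i\|<\infty$, the series $\sum_{i=1}^\infty a_i x_i$ converges in norm. -/

import Mathlib

open Filter Topology

/-- A Schauder basis `(eᵢ)` is unconditional if, for some constant `D`,
`‖∑_{i<n} εᵢ cᵢ eᵢ‖ ≤ D ‖∑_{i<n} cᵢ eᵢ‖` for all `n`, all scalars `c` and all signs `ε`. -/
def IsUnconditionalBasis {X : Type*} [NormedAddCommGroup X] [NormedSpace ℝ X]
    (e : SchauderBasis ℝ X) : Prop :=
  ∃ D : ℝ, ∀ (n : ℕ) (c ε : ℕ → ℝ), (∀ i, ε i = 1 ∨ ε i = -1) →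
    ‖∑ i ∈ Finset.range n, (ε i * c i) • e i‖ ≤ D * ‖∑ i ∈ Finset.range n, c i • e i‖

/-- A Schauder basis is pre-monotone if all the tail projections `Rₙ = I - Pₙ`, where
`Pₙ x = ∑_{i<n} eᵢ*(x) eᵢ`, satisfy `‖Rₙ x‖ ≤ ‖x‖`. -/
def IsPremonotoneBasis {X : Type*} [NormedAddCommGroup X] [NormedSpace ℝ X]
    (e : SchauderBasis ℝ X) : Prop :=
  ∀ (n : ℕ) (x : X), ‖x - ∑ i ∈ Finset.range n, e.coord i x • e i‖ ≤ ‖x‖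

/-- A sequence is basic if it is a Schauder basis of its closed linear span. -/
def IsBasicSequence {X : Type*} [NormedAddCommGroup X] [NormedSpace ℝ X]
    (x : ℕ → X) : Prop :=
  ∃ e : SchauderBasis ℝ (Submodule.span ℝ (Set.range x)).topologicalClosure,
    ∀ n, (e n : X) = x n

/-- A (basic) sequence is boundedly complete if every series `∑ aᵢ xᵢ` with bounded partial
sums converges in norm. -/
def IsBoundedlyComplete {X : Type*} [NormedAddCommGroup X] [NormedSpace ℝ X]
    (x : ℕ → X) : Prop :=
  ∀ a : ℕ → ℝ,
    (∃ M : ℝ, ∀ N : ℕ, ‖∑ i ∈ Finset.range N, a i • x i‖ ≤ M) →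
    ∃ s : X, Tendsto (fun N : ℕ => ∑ i ∈ Finset.range N, a i • x i) atTop (𝓝 s)

/-- Some subspace of `X` is (linearly) isomorphic to the real space `ℓ₁`. -/
def ContainsEllOne (X : Type*) [NormedAddCommGroup X] [NormedSpace ℝ X] : Prop :=
  ∃ Y : Submodule ℝ X, Nonempty (lp (fun _ : ℕ => ℝ) 1 ≃L[ℝ] Y)

/-- `T` restricts to an affine self-map of the set `C` that is nonexpansive (1-Lipschitz). -/
structure IsAffineNonexpansiveSelfMap {X : Type*} [NormedAddCommGroup X] [NormedSpace ℝ X]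
    (T : X → X) (C : Set X) : Prop where
  mapsTo : ∀ x ∈ C, T x ∈ C
  nonexpansive : ∀ x ∈ C, ∀ y ∈ C, ‖T x - T y‖ ≤ ‖x - y‖
  affine : ∀ x ∈ C, ∀ y ∈ C, ∀ t : ℝ, 0 ≤ t → t ≤ 1 →
    T (t • x + (1 - t) • y) = t • T x + (1 - t) • T y

/-- The fixed point property for affine nonexpansive mappings: every such self-map of a nonempty
closed bounded convex subset has a fixed point. -/
def HasAffineFPP (X : Type*) [NormedAddCommGroup X] [NormedSpace ℝ X] : Prop :=
  ∀ C : Set X, C.Nonempty → IsClosed C → Bornology.IsBounded C → Convex ℝ C →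
    ∀ T : X → X, IsAffineNonexpansiveSelfMap T C → ∃ x ∈ C, T x = x

/-! Everything depends on whether the basis `e` itself is boundedly complete. If it is, the absence
of `ℓ₁` forces bounded sequences to have weakly convergent subsequences: coordinatewise limits exist
by compactness, lie in `X` by bounded completeness, and are weak limits by a gliding hump argument.
Weak limits of approximate fixed points are then fixed, and all basic sequences are boundedly
complete.

If it is not, take `a` with bounded but divergent partial sums. On the box of `x` with coordinates
between `0` and `a i`, a weighted average of tail projections plus a translation moves each
coordinate towards `a i`. A fixed point would have to be the missing sum. -/

/-! ### Unconditionality, `ℓ₁` and weak convergence -/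

/-- A bounded sequence with a lower `ℓ₁`-estimate spans a copy of `ℓ₁`. -/
theorem containsEllOne_of_lower_estimate {X : Type*} [NormedAddCommGroup X] [NormedSpace ℝ X]
    [CompleteSpace X] (u : ℕ → X) (B K : ℝ) (hB : ∀ k, ‖u k‖ ≤ B) (hK : 0 < K)
    (h : ∀ (a : ℕ → ℝ) (n : ℕ),
      ∑ k ∈ Finset.range n, |a k| ≤ K * ‖∑ k ∈ Finset.range n, a k • u k‖) :
    ContainsEllOne X := by
  have hB0 : 0 ≤ B := (norm_nonneg _).trans (hB 0)
  have habs (a : lp (fun _ : ℕ => ℝ) 1) : HasSum (fun k => |a k|) ‖a‖ := by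
    simpa using lp.hasSum_norm (p := 1) (by simp) a
  have hle (a : lp (fun _ : ℕ => ℝ) 1) (k : ℕ) : ‖a k • u k‖ ≤ |a k| * B := by
    rw [norm_smul, Real.norm_eq_abs]
    exact mul_le_mul_of_nonneg_left (hB k) (abs_nonneg _)
  have hsum (a : lp (fun _ : ℕ => ℝ) 1) : Summable fun k => a k • u k :=
    .of_norm_bounded ((habs a).mul_right B).summable (hle a)
  let L : lp (fun _ : ℕ => ℝ) 1 →L[ℝ] X := LinearMap.mkContinuous
    { toFun := fun a => ∑' k, a k • u k
      map_add' := fun a b => by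
        rw [← (hsum a).tsum_add (hsum b)]
        simp [add_smul]
      map_smul' := fun c a => by
        simp only [lp.coeFn_smul, Pi.smul_apply, smul_eq_mul, mul_smul, RingHom.id_apply]
        exact (hsum a).tsum_const_smul c } B
    (fun a => by
      rw [mul_comm]
      exact tsum_of_norm_bounded ((habs a).mul_right B) (hle a))
  have hL (a : lp (fun _ : ℕ => ℝ) 1) : ‖a‖ ≤ K * ‖L a‖ :=
    le_of_tendsto_of_tendsto' (habs a).tendsto_sum_nat
      ((hsum a).hasSum.tendsto_sum_nat.norm.const_mul K) (fun n => h _ n)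
  have hanti : AntilipschitzWith K.toNNReal L :=
    ContinuousLinearMap.antilipschitz_of_bound L (by simpa [hK.le] using hL)
  exact ⟨_, ⟨L.equivRange hanti.injective (hanti.isClosed_range L.uniformContinuous)⟩⟩

/-- Blocks of an unconditional basis on which a functional is bounded below satisfy a lower
`ℓ₁`-estimate. -/
theorem IsUnconditionalBasis.exists_block_lower_estimate {X : Type*} [NormedAddCommGroup X]
    [NormedSpace ℝ X] {e : SchauderBasis ℝ X} (he : IsUnconditionalBasis e) (m : ℕ → ℕ)
    (hm : Monotone m) (hm0 : m 0 = 0) (c : ℕ → ℕ → ℝ) (f : StrongDual ℝ X) (δ : ℝ) (hδ : 0 < δ)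
    (hf : ∀ k, δ ≤ f (∑ i ∈ Finset.Ico (m k) (m (k + 1)), c k i • e i)) :
    ∃ K > 0, ∀ (a : ℕ → ℝ) (n : ℕ), ∑ k ∈ Finset.range n, |a k| ≤
      K * ‖∑ k ∈ Finset.range n, a k • ∑ i ∈ Finset.Ico (m k) (m (k + 1)), c k i • e i‖ := by
  obtain ⟨D, hD⟩ := he
  -- `κ i` is the block containing `i`; it turns block coefficients into coefficients of the basis.
  obtain ⟨κ, hκ⟩ : ∃ κ : ℕ → ℕ, ∀ k, ∀ i ∈ Finset.Ico (m k) (m (k + 1)), κ i = k := by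
    refine ⟨fun i => sInf {k | i < m (k + 1)}, fun k i hi => ?_⟩
    rw [Finset.mem_Ico] at hi
    refine le_antisymm (Nat.sInf_le hi.2) (le_csInf ⟨k, hi.2⟩ fun j hj => ?_)
    by_contra! hlt
    exact absurd (hm (Nat.succ_le_of_lt hlt)) (not_le.2 (hi.1.trans_lt hj))
  have hblock (b : ℕ → ℝ) (n : ℕ) :
      ∑ k ∈ Finset.range n, b k • ∑ i ∈ Finset.Ico (m k) (m (k + 1)), c k i • e i =
        ∑ i ∈ Finset.range (m n), (b (κ i) * c (κ i) i) • e i := by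
    induction n with
    | zero => simp [hm0]
    | succ n ih =>
      rw [Finset.sum_range_succ, ih, ← Finset.sum_range_add_sum_Ico _ (hm n.le_succ)]
      congr 1
      rw [Finset.smul_sum]
      refine Finset.sum_congr rfl fun i hi => ?_
      rw [hκ n i hi, mul_smul]
  have hpos : 0 < (‖f‖ * |D| + 1) / δ := by positivity
  refine ⟨_, hpos, fun a n => ?_⟩
  set N := ‖∑ k ∈ Finset.range n, a k • ∑ i ∈ Finset.Ico (m k) (m (k + 1)), c k i • e i‖ with hN
  have hunc : ‖∑ k ∈ Finset.range n, |a k| • ∑ i ∈ Finset.Ico (m k) (m (k + 1)), c k i • e i‖ ≤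
      D * N := by
    rw [hN, hblock, hblock]
    -- Flipping signs blockwise replaces `a k` by `|a k|`, so that the values of `f` cannot cancel.
    refine le_of_eq_of_le ?_ (hD (m n) (fun i => a (κ i) * c (κ i) i)
      (fun i => if 0 ≤ a (κ i) then 1 else -1) (fun i => by by_cases h : 0 ≤ a (κ i) <;> simp [h]))
    congr 1
    refine Finset.sum_congr rfl fun i _ => ?_
    by_cases h : 0 ≤ a (κ i)
    · simp [h, abs_of_nonneg h]
    · simp [h, abs_of_neg (not_le.1 h)]
  have hlow : (∑ k ∈ Finset.range n, |a k|) * δ ≤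
      f (∑ k ∈ Finset.range n, |a k| • ∑ i ∈ Finset.Ico (m k) (m (k + 1)), c k i • e i) := by
    rw [map_sum, Finset.sum_mul]
    refine Finset.sum_le_sum fun k _ => ?_
    rw [map_smul, smul_eq_mul]
    exact mul_le_mul_of_nonneg_left (hf k) (abs_nonneg _)
  have hN0 : 0 ≤ N := norm_nonneg _
  rw [div_mul_eq_mul_div, le_div_iff₀ hδ]
  calc _ ≤ _ := hlow
    _ ≤ ‖f‖ * (D * N) := ((le_abs_self _).trans (f.le_opNorm _)).trans
        (mul_le_mul_of_nonneg_left hunc (norm_nonneg _))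
    _ ≤ ‖f‖ * (|D| * N) := by gcongr; exact le_abs_self D
    _ ≤ (‖f‖ * |D| + 1) * N := by nlinarith

/-- In a space without copies of `ℓ₁`, bounded sequences that are coordinatewise null with respect
to an unconditional basis are weakly null. -/
theorem IsUnconditionalBasis.tendsto_zero_of_coord {X : Type*} [NormedAddCommGroup X]
    [NormedSpace ℝ X] [CompleteSpace X] {e : SchauderBasis ℝ X} (he : IsUnconditionalBasis e)
    (hX : ¬ ContainsEllOne X) (y : ℕ → X) (B : ℝ) (hB : ∀ n, ‖y n‖ ≤ B)
    (hy : ∀ i, Tendsto (fun n => e.coord i (y n)) atTop (𝓝 0)) (f : StrongDual ℝ X) :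
    Tendsto (fun n => f (y n)) atTop (𝓝 0) := by
  by_contra hcon
  obtain ⟨ε, hε, hfreq⟩ : ∃ ε > 0, ∀ N, ∃ n ≥ N, ε ≤ |f (y n)| := by
    simpa [Metric.tendsto_atTop] using hcon
  have hproj (M : ℕ) : Tendsto (fun n => f (e.proj M (y n))) atTop (𝓝 0) := by
    simpa using tendsto_finsetSum (Finset.range M) fun i _ => (hy i).mul_const (f (e i))
  -- Gliding hump: up to sign `f z ≥ ε`; discarding the head before `M` and a far tail costs at most
  -- `ε / 4` each.
  have hstep (M : ℕ) : ∃ z : X, ‖z‖ ≤ B ∧ ∃ M' > M, ε / 2 ≤ f (e.proj M' z - e.proj M z) := by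
    obtain ⟨N, hN⟩ := Metric.tendsto_atTop.1 (hproj M) (ε / 4) (by positivity)
    obtain ⟨n, hn, hfn⟩ := hfreq N
    have h1 := hN n hn
    rw [Real.dist_eq, sub_zero] at h1
    obtain ⟨z, hz, hfz, hpz⟩ : ∃ z : X, ‖z‖ ≤ B ∧ ε ≤ f z ∧ |f (e.proj M z)| < ε / 4 := by
      rcases le_abs'.1 hfn with h | h
      · exact ⟨-y n, by simpa using hB n, by rw [map_neg]; linarith,
          by rwa [map_neg, map_neg, abs_neg]⟩
      · exact ⟨y n, hB n, h, h1⟩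
    obtain ⟨N', hN'⟩ := Metric.tendsto_atTop.1 ((f.continuous.tendsto z).comp (e.tendsto_proj z))
      (ε / 4) (by positivity)
    have h2 := hN' (max N' (M + 1)) (le_max_left _ _)
    refine ⟨z, hz, max N' (M + 1), lt_of_lt_of_le M.lt_succ_self (le_max_right _ _), ?_⟩
    rw [Function.comp_apply, Real.dist_eq] at h2
    rw [map_sub]
    have := abs_lt.1 h2
    have := abs_lt.1 hpz
    linarith
  choose z hz g hg hfz using hstep
  let m : ℕ → ℕ := fun k => g^[k] 0
  have hms (k : ℕ) : m (k + 1) = g (m k) := Function.iterate_succ_apply' g k 0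
  have hm : Monotone m := monotone_nat_of_le_succ fun k => by rw [hms]; exact (hg _).le
  have hu (k : ℕ) : ∑ i ∈ Finset.Ico (m k) (m (k + 1)), e.coord i (z (m k)) • e i =
      e.proj (g (m k)) (z (m k)) - e.proj (m k) (z (m k)) := by
    rw [Finset.sum_Ico_eq_sub _ (hm k.le_succ), hms, e.proj_apply, e.proj_apply]
  obtain ⟨K, hK, hlow⟩ := he.exists_block_lower_estimate m hm rfl
    (fun k i => e.coord i (z (m k))) f (ε / 2) (by positivity) (fun k => by
      rw [hu]; exact hfz (m k))
  obtain ⟨C, hC⟩ := e.exists_norm_proj_le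
  have hPz (n M : ℕ) : ‖e.proj n (z M)‖ ≤ C * B :=
    (e.proj n).le_of_opNorm_le_of_le (hC n) (hz M)
  refine hX (containsEllOne_of_lower_estimate _ (C * B + C * B) K (fun k => ?_) hK hlow)
  rw [hu]
  exact (norm_sub_le _ _).trans (add_le_add (hPz _ _) (hPz _ _))

/-- If an unconditional basis is boundedly complete and the space contains no copy of `ℓ₁`, then
bounded sequences have weakly convergent subsequences. -/
theorem IsUnconditionalBasis.exists_weakly_convergent_subseq {X : Type*} [NormedAddCommGroup X]
    [NormedSpace ℝ X] [CompleteSpace X] {e : SchauderBasis ℝ X} (he : IsUnconditionalBasis e)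
    (hX : ¬ ContainsEllOne X) (hbc : IsBoundedlyComplete e) (y : ℕ → X) (B : ℝ)
    (hB : ∀ n, ‖y n‖ ≤ B) :
    ∃ (s : X) (φ : ℕ → ℕ), StrictMono φ ∧
      ∀ f : StrongDual ℝ X, Tendsto (fun n => f (y (φ n))) atTop (𝓝 (f s)) := by
  have hcompact : IsCompact (Set.univ.pi fun i => Metric.closedBall (0 : ℝ) (‖e.coord i‖ * B)) :=
    isCompact_univ_pi fun i => isCompact_closedBall _ _
  obtain ⟨a, -, φ, hφ, ha⟩ := hcompact.tendsto_subseq (x := fun n i => e.coord i (y n))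
    (fun n i _ => by
      rw [mem_closedBall_zero_iff]
      exact (e.coord i).le_of_opNorm_le_of_le le_rfl (hB n))
  have ha (i : ℕ) : Tendsto (fun n => e.coord i (y (φ n))) atTop (𝓝 (a i)) :=
    (tendsto_pi_nhds.1 ha) i
  obtain ⟨C, hC⟩ := e.exists_norm_proj_le
  -- The partial sums of `a` are limits of projections of `y (φ n)`, hence bounded.
  obtain ⟨s, hs⟩ := hbc a ⟨C * B, fun N => by
    refine le_of_tendsto'
      (tendsto_finsetSum (Finset.range N) fun i _ => (ha i).smul_const (e i)).norm fun n => ?_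
    rw [← e.proj_apply]
    exact (e.proj N).le_of_opNorm_le_of_le (hC N) (hB _)⟩
  have hsa (i : ℕ) : e.coord i s = a i := by
    refine tendsto_nhds_unique (((e.coord i).continuous.tendsto s).comp hs)
      (tendsto_const_nhds.congr' ?_)
    filter_upwards [eventually_gt_atTop i] with N hN
    simp [e.ortho, Pi.single_apply, hN]
  refine ⟨s, φ, hφ, fun f => ?_⟩
  have := he.tendsto_zero_of_coord hX (fun n => y (φ n) - s) (B + ‖s‖)
    (fun n => (norm_sub_le _ _).trans (by gcongr; exact hB _))
    (fun i => by simpa [hsa] using (ha i).sub_const (a i)) f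
  simpa using this.add_const (f s)

/-! ### Approximate fixed points and basic sequences -/

/-- Closed convex sets are weakly sequentially closed. -/
theorem Convex.mem_of_weakly_tendsto {X : Type*} [NormedAddCommGroup X] [NormedSpace ℝ X]
    {C : Set X} (hC : Convex ℝ C) (hcl : IsClosed C) {y : ℕ → X} {s : X}
    (hy : ∀ᶠ n in atTop, y n ∈ C)
    (hs : ∀ f : StrongDual ℝ X, Tendsto (fun n => f (y n)) atTop (𝓝 (f s))) : s ∈ C := by
  by_contra hsC
  obtain ⟨f, u, hfu, hu⟩ := geometric_hahn_banach_point_closed hC hcl hsC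
  exact not_le.2 hfu (ge_of_tendsto (hs f) (hy.mono fun n hn => (hu _ hn).le))

/-- Nonexpansive self-maps of bounded closed convex sets have approximate fixed points. -/
theorem IsAffineNonexpansiveSelfMap.exists_norm_sub_le {X : Type*} [NormedAddCommGroup X]
    [NormedSpace ℝ X] [CompleteSpace X] {T : X → X} {C : Set X}
    (hT : IsAffineNonexpansiveSelfMap T C) (hne : C.Nonempty) (hcl : IsClosed C)
    (hb : Bornology.IsBounded C) (hC : Convex ℝ C) {ε : ℝ} (hε : 0 < ε) :
    ∃ x ∈ C, ‖T x - x‖ ≤ ε := by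
  obtain ⟨x₀, hx₀⟩ := hne
  obtain ⟨R, hR, hdist⟩ : ∃ R > 0, ∀ x ∈ C, ‖x - x₀‖ ≤ R := by
    obtain ⟨R, hR⟩ := hb.subset_closedBall x₀
    exact ⟨max R 1, by positivity, fun x hx => (mem_closedBall_iff_norm.1 (hR hx)).trans
      (le_max_left _ _)⟩
  obtain ⟨t, ht0, ht1, htR⟩ : ∃ t : ℝ, 0 < t ∧ t < 1 ∧ t * R ≤ ε := by
    refine ⟨min (ε / R) (1 / 2), by positivity, (min_le_right _ _).trans_lt (by norm_num), ?_⟩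
    calc _ ≤ ε / R * R := by gcongr; exact min_le_left _ _
      _ = ε := div_mul_cancel₀ _ hR.ne'
  -- Mixing in `x₀` with weight `t` gives a strict contraction, whose fixed point satisfies `T x - x
  -- = t • (T x - x₀)`.
  let S : C → C := fun x => ⟨t • x₀ + (1 - t) • T x,
    hC hx₀ (hT.mapsTo x x.2) ht0.le (by linarith) (by ring)⟩
  have hS : ContractingWith (1 - t).toNNReal S := by
    refine ⟨by rw [Real.toNNReal_lt_one]; linarith, LipschitzWith.of_dist_le_mul fun x y => ?_⟩
    rw [Real.coe_toNNReal _ (by linarith), Subtype.dist_eq, Subtype.dist_eq, dist_eq_norm,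
      dist_eq_norm]
    calc _ = ‖(1 - t) • (T x - T y)‖ := by congr 1; simp only [S]; module
      _ = (1 - t) * ‖T x - T y‖ := by rw [norm_smul, Real.norm_of_nonneg (by linarith)]
      _ ≤ _ := mul_le_mul_of_nonneg_left (hT.nonexpansive x x.2 y y.2) (by linarith)
  have : Nonempty C := ⟨⟨x₀, hx₀⟩⟩
  have : CompleteSpace C := hcl.completeSpace_coe
  obtain ⟨x, hx⟩ : ∃ x : C, S x = x := ⟨_, hS.fixedPoint_isFixedPt⟩
  have hx : t • x₀ + (1 - t) • T x = x := congrArg Subtype.val hx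
  refine ⟨x, x.2, le_trans (le_of_eq ?_) ((mul_le_mul_of_nonneg_left
    (hdist _ (hT.mapsTo x x.2)) ht0.le).trans htR)⟩
  calc ‖T x - x‖ = ‖t • (T x - x₀)‖ := by
        conv_lhs => enter [1, 2]; rw [← hx]
        congr 1
        module
    _ = t * ‖T x - x₀‖ := by rw [norm_smul, Real.norm_of_nonneg ht0.le]

/-- If bounded sequences have weakly convergent subsequences, then the fixed point property for
affine nonexpansive mappings holds. -/
theorem hasAffineFPP_of_weakly_convergent_subseq {X : Type*} [NormedAddCommGroup X]
    [NormedSpace ℝ X] [CompleteSpace X]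
    (h : ∀ (y : ℕ → X) (B : ℝ), (∀ n, ‖y n‖ ≤ B) → ∃ (s : X) (φ : ℕ → ℕ), StrictMono φ ∧
      ∀ f : StrongDual ℝ X, Tendsto (fun n => f (y (φ n))) atTop (𝓝 (f s))) :
    HasAffineFPP X := by
  intro C hne hcl hb hC T hT
  choose y hyC hy using fun n : ℕ =>
    hT.exists_norm_sub_le hne hcl hb hC (Nat.one_div_pos_of_nat (α := ℝ) (n := n))
  obtain ⟨B, hB⟩ := isBounded_iff_forall_norm_le.1 hb
  obtain ⟨s, φ, hφ, hs⟩ := h y B fun n => hB _ (hyC n)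
  have hcont : ContinuousOn T C :=
    (LipschitzOnWith.of_dist_le_mul (K := 1) fun x hx y hy => by
      simpa [dist_eq_norm] using hT.nonexpansive x hx y hy).continuousOn
  -- Since `T` is affine, its `ε`-approximate fixed points form a closed convex set, which contains
  -- the weak limit.
  have hmem (ε : ℝ) (hε : 0 < ε) : s ∈ {x ∈ C | ‖T x - x‖ ≤ ε} := by
    refine Convex.mem_of_weakly_tendsto (y := fun n => y (φ n)) (fun x hx z hz a b ha hb hab => ?_)
      ?_ ?_ hs
    · refine ⟨hC hx.1 hz.1 ha hb hab, ?_⟩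
      obtain rfl : b = 1 - a := by linarith
      rw [hT.affine x hx.1 z hz.1 a ha (by linarith)]
      calc _ = ‖a • (T x - x) + (1 - a) • (T z - z)‖ := by congr 1; module
        _ ≤ a * ‖T x - x‖ + (1 - a) * ‖T z - z‖ := by
          refine (norm_add_le _ _).trans (le_of_eq ?_)
          rw [norm_smul, norm_smul, Real.norm_of_nonneg ha, Real.norm_of_nonneg hb]
        _ ≤ a * ε + (1 - a) * ε := by gcongr; exacts [hx.2, hz.2]
        _ = ε := by ring
    · exact (hcont.sub continuousOn_id).norm.preimage_isClosed_of_isClosed hcl isClosed_Iic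
    · filter_upwards [(tendsto_one_div_add_atTop_nhds_zero_nat (𝕜 := ℝ)).comp hφ.tendsto_atTop
        |>.eventually (Iic_mem_nhds hε)] with n hn
      exact ⟨hyC _, (hy _).trans hn⟩
  refine ⟨s, (hmem 1 one_pos).1, sub_eq_zero.1 (norm_le_zero_iff.1 ?_)⟩
  exact le_of_forall_pos_le_add fun ε hε => by simpa using (hmem ε hε).2

/-- If bounded sequences have weakly convergent subsequences, then every basic sequence is
boundedly complete. -/
theorem IsBasicSequence.isBoundedlyComplete {X : Type*} [NormedAddCommGroup X]
    [NormedSpace ℝ X] {x : ℕ → X} (hx : IsBasicSequence x)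
    (h : ∀ (y : ℕ → X) (B : ℝ), (∀ n, ‖y n‖ ≤ B) → ∃ (s : X) (φ : ℕ → ℕ), StrictMono φ ∧
      ∀ f : StrongDual ℝ X, Tendsto (fun n => f (y (φ n))) atTop (𝓝 (f s))) :
    IsBoundedlyComplete x := by
  rintro a ⟨M, hM⟩
  obtain ⟨b, hb⟩ := hx
  obtain ⟨s, φ, hφ, hs⟩ := h _ M hM
  let V := (Submodule.span ℝ (Set.range x)).topologicalClosure
  have hsV : s ∈ V := by
    refine Convex.mem_of_weakly_tendsto V.convex (Submodule.isClosed_topologicalClosure _)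
      (.of_forall fun n => ?_) hs
    exact V.sum_mem fun i _ => V.smul_mem _ (hb i ▸ (b i).2)
  have hcoord (i : ℕ) : b.coord i ⟨s, hsV⟩ = a i := by
    -- The weak convergence is tested on functionals on `X`, so the coordinate functional is
    -- extended by Hahn–Banach.
    obtain ⟨g, hg, -⟩ := exists_extension_norm_eq V (b.coord i)
    have hgx (j : ℕ) : g (x j) = (Pi.single j (1 : ℝ) : ℕ → ℝ) i := by
      rw [← hb j, hg, b.ortho]
      simp [Pi.single_apply]
    rw [← hg]
    refine tendsto_nhds_unique (hs g) (tendsto_const_nhds.congr' ?_)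
    filter_upwards [hφ.tendsto_atTop.eventually (eventually_gt_atTop i)] with n hn
    simp [hgx, Pi.single_apply, hn]
  refine ⟨s, ?_⟩
  have := (continuous_subtype_val.tendsto _).comp (b.tendsto_proj ⟨s, hsV⟩)
  refine this.congr fun N => ?_
  simp [hcoord, hb]

/-- A Schauder basis is a basic sequence. -/
theorem SchauderBasis.isBasicSequence {X : Type*} [NormedAddCommGroup X] [NormedSpace ℝ X]
    (e : SchauderBasis ℝ X) : IsBasicSequence e := by
  set V := (Submodule.span ℝ (Set.range e)).topologicalClosure with hV
  have hmem (i : ℕ) : e i ∈ V :=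
    Submodule.le_topologicalClosure _ (Submodule.subset_span ⟨i, rfl⟩)
  refine ⟨⟨fun i => ⟨e i, hmem i⟩, fun i => (e.coord i).comp V.subtypeL, fun i j => e.ortho i j,
    fun v => ?_⟩, fun n => rfl⟩
  have := e.expansion v
  rw [HasSum, tendsto_subtype_rng]
  simpa [HasSum] using this

/-! ### A fixed-point-free affine nonexpansive map -/

/-- A convex combination of the tail projections of a pre-monotone basis is a contraction that
acts diagonally on the coordinates. -/
theorem IsPremonotoneBasis.exists_diagonal_contraction {X : Type*} [NormedAddCommGroup X]
    [NormedSpace ℝ X] [CompleteSpace X] {e : SchauderBasis ℝ X} (hp : IsPremonotoneBasis e)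
    {w : ℕ → ℝ} (hw0 : ∀ n, 0 ≤ w n) (hw : HasSum w 1) :
    ∃ L : X →L[ℝ] X, (∀ x, ‖L x‖ ≤ ‖x‖) ∧
      ∀ i x, e.coord i (L x) = (∑ n ∈ Finset.range (i + 1), w n) * e.coord i x := by
  have hR (n : ℕ) : ‖w n • (ContinuousLinearMap.id ℝ X - e.proj n)‖ ≤ w n := by
    rw [norm_smul, Real.norm_of_nonneg (hw0 n)]
    refine mul_le_of_le_one_right (hw0 n)
      (ContinuousLinearMap.opNorm_le_bound _ zero_le_one fun x => ?_)
    simpa using hp n x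
  obtain ⟨L, hL⟩ : Summable fun n => w n • (ContinuousLinearMap.id ℝ X - e.proj n) :=
    .of_norm_bounded hw.summable hR
  have hL1 : ‖L‖ ≤ 1 := hL.tsum_eq ▸ tsum_of_norm_bounded hw hR
  refine ⟨L, fun x => by simpa using L.le_of_opNorm_le hL1 x, fun i x => ?_⟩
  have hLx : HasSum (fun n => w n • (x - e.proj n x)) (L x) := by
    simpa using hL.mapL (ContinuousLinearMap.apply ℝ X x)
  have h1 : HasSum (fun n => e.coord i (w n • (x - e.proj n x))) (e.coord i (L x)) :=
    hLx.mapL (e.coord i)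
  -- The `n`-th tail projection keeps coordinate `i` exactly when `n ≤ i`.
  have h2 (n : ℕ) : e.coord i (w n • (x - e.proj n x)) =
      if n < i + 1 then w n * e.coord i x else 0 := by
    rw [map_smul, map_sub, e.proj_apply, map_sum, smul_eq_mul]
    by_cases h : i < n
    · simp [h, e.ortho, Pi.single_apply, not_lt.2 (Nat.succ_le_of_lt h)]
    · simp [h, e.ortho, Pi.single_apply, Nat.lt_succ_of_le (not_lt.1 h)]
  have h3 : HasSum (fun n => e.coord i (w n • (x - e.proj n x)))
      (∑ n ∈ Finset.range (i + 1), e.coord i (w n • (x - e.proj n x))) :=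
    hasSum_sum_of_ne_finset_zero fun n hn => by
      rw [h2, if_neg (by simpa using hn)]
  rw [h1.unique h3, Finset.sum_mul]
  refine Finset.sum_congr rfl fun n hn => ?_
  rw [h2, if_pos (Finset.mem_range.1 hn)]

/-- If all signed sums of a finite family are bounded by `B`, then so are all its combinations
with coefficients of absolute value at most `1`. -/
theorem norm_sum_smul_le_of_signs {ι X : Type*} [NormedAddCommGroup X] [NormedSpace ℝ X]
    (s : Finset ι) (v : ι → X) (B : ℝ)
    (h : ∀ ε : ι → ℝ, (∀ i, ε i = 1 ∨ ε i = -1) → ‖∑ i ∈ s, ε i • v i‖ ≤ B)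
    (t : ι → ℝ) (ht : ∀ i, |t i| ≤ 1) : ‖∑ i ∈ s, t i • v i‖ ≤ B := by
  -- Under a norming functional, the worst coefficients are the signs of `f (v i)`.
  obtain ⟨f, hf1, hf⟩ := exists_dual_vector'' ℝ (∑ i ∈ s, t i • v i)
  calc ‖∑ i ∈ s, t i • v i‖ = f (∑ i ∈ s, t i • v i) := by rw [hf]; rfl
    _ = ∑ i ∈ s, t i * f (v i) := by simp
    _ ≤ ∑ i ∈ s, |f (v i)| := Finset.sum_le_sum fun i _ => by
      refine (le_abs_self _).trans ?_
      rw [abs_mul]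
      exact mul_le_of_le_one_left (abs_nonneg _) (ht i)
    _ = f (∑ i ∈ s, (if 0 ≤ f (v i) then (1 : ℝ) else -1) • v i) := by
      rw [map_sum]
      refine Finset.sum_congr rfl fun i _ => ?_
      by_cases hi : 0 ≤ f (v i)
      · simp [hi, abs_of_nonneg hi]
      · simp [hi, abs_of_neg (not_le.1 hi)]
    _ ≤ ‖∑ i ∈ s, (if 0 ≤ f (v i) then (1 : ℝ) else -1) • v i‖ :=
      (le_abs_self _).trans ((f.le_of_opNorm_le hf1 _).trans_eq (one_mul _))
    _ ≤ B := h _ fun i => by by_cases hi : 0 ≤ f (v i) <;> simp [hi]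

/-- If a pre-monotone unconditional basis is not boundedly complete, then the fixed point property
for affine nonexpansive mappings fails. -/
theorem IsPremonotoneBasis.not_hasAffineFPP {X : Type*} [NormedAddCommGroup X]
    [NormedSpace ℝ X] [CompleteSpace X] {e : SchauderBasis ℝ X} (hp : IsPremonotoneBasis e)
    (hu : IsUnconditionalBasis e) (hbc : ¬ IsBoundedlyComplete e) : ¬ HasAffineFPP X := by
  simp only [IsBoundedlyComplete, not_forall, exists_prop] at hbc
  obtain ⟨a, ⟨M, hM⟩, hdiv⟩ := hbc
  obtain ⟨D, hD⟩ := hu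
  -- With `w n = 2 ^ (-(n + 1))`, coordinate `i` of `L x + b` is a convex combination of `e.coord i
  -- x` and `a i`.
  obtain ⟨w, hw0, hw, hwsum⟩ : ∃ w : ℕ → ℝ, (∀ n, 0 < w n) ∧ HasSum w 1 ∧
      ∀ i, ∑ n ∈ Finset.range (i + 1), w n = 1 - w i := by
    refine ⟨fun n => 1 / 2 / 2 ^ n, fun n => by positivity, hasSum_geometric_two' 1, fun i => ?_⟩
    induction i with
    | zero => norm_num
    | succ i ih =>
      rw [Finset.sum_range_succ, ih, pow_succ]
      field_simp
      ring
  obtain ⟨L, hL, hLc⟩ := hp.exists_diagonal_contraction (fun n => (hw0 n).le) hw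
  have hae (i : ℕ) : ‖a i • e i‖ ≤ M + M := by
    have := Finset.sum_range_succ (fun i => a i • e i) i
    rw [← sub_eq_iff_eq_add'] at this
    rw [← this]
    exact (norm_sub_le _ _).trans (add_le_add (hM _) (hM _))
  -- The weights make this series converge although `∑ a i • e i` diverges.
  obtain ⟨b, hb⟩ : Summable fun i => w i • a i • e i :=
    .of_norm_bounded (hw.mul_right (M + M)).summable fun i => by
      rw [norm_smul, Real.norm_of_nonneg (hw0 i).le]
      exact mul_le_mul_of_nonneg_left (hae i) (hw0 i).le
  have hbc (i : ℕ) : e.coord i b = w i * a i := by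
    have hi : HasSum (fun j => if j = i then w i * a i else 0) (e.coord i b) := by
      refine (hb.mapL (e.coord i)).congr_fun fun j => ?_
      by_cases h : j = i
      · simp [h, e.ortho]
      · simp [h, e.ortho, Ne.symm h]
    exact hi.unique (hasSum_ite_eq i _)
  have hTc (i : ℕ) (x : X) : e.coord i (L x + b) = (1 - w i) * e.coord i x + w i * a i := by
    rw [map_add, hLc, hwsum, hbc]
  have hw1 (i : ℕ) : w i ≤ 1 := le_hasSum hw i fun j _ => (hw0 j).le
  intro hF
  suffices h : ∃ x ∈ {x | ∀ i, e.coord i x ∈ Set.uIcc 0 (a i)}, L x + b = x by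
    obtain ⟨x, -, hx⟩ := h
    refine hdiv ⟨x, (e.tendsto_proj x).congr fun N => ?_⟩
    rw [e.proj_apply]
    refine Finset.sum_congr rfl fun i _ => ?_
    have := hTc i x
    rw [hx] at this
    rw [mul_left_cancel₀ (hw0 i).ne' (by linarith : w i * e.coord i x = w i * a i)]
  refine hF {x | ∀ i, e.coord i x ∈ Set.uIcc 0 (a i)} ⟨0, fun i => by simp⟩ ?_ ?_ ?_
    (fun x => L x + b) ⟨fun x hx i => ?_, fun x _ y _ => ?_, fun x _ y _ t _ _ => ?_⟩
  · rw [Set.ofPred_forall]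
    exact isClosed_iInter fun i => isClosed_Icc.preimage (e.coord i).continuous
  · refine isBounded_iff_forall_norm_le.2 ⟨|D| * M, fun x hx => ?_⟩
    refine le_of_tendsto' (e.tendsto_proj x).norm fun n => ?_
    -- Writing the coordinates as `t i * a i` with `|t i| ≤ 1` lets unconditionality bound the box.
    have ht (i : ℕ) : ∃ t : ℝ, |t| ≤ 1 ∧ t * a i = e.coord i x := by
      have := hx i
      rw [← segment_eq_uIcc, segment_eq_image] at this
      obtain ⟨t, ht, hta⟩ := this
      exact ⟨t, abs_le.2 ⟨by linarith [ht.1], ht.2⟩, by simpa using hta⟩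
    choose t ht hta using ht
    simp only [e.proj_apply, ← hta, mul_smul]
    refine norm_sum_smul_le_of_signs _ (fun i => a i • e i) _ (fun ε hε => ?_) t ht
    simp only [← mul_smul]
    exact (hD n a ε hε).trans
      (mul_le_mul (le_abs_self D) (hM n) (norm_nonneg _) (abs_nonneg D))
  · rw [Set.ofPred_forall]
    exact convex_iInter fun i => (convex_uIcc 0 (a i)).linear_preimage (e.coord i).toLinearMap
  · rw [hTc]
    exact convex_uIcc 0 (a i) (hx i) Set.right_mem_uIcc (by linarith [hw1 i]) (hw0 i).le (by ring)
  · simpa using hL (x - y)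
  · simp only [map_add, map_smul]
    module

theorem mainTheorem9 {X : Type*} [NormedAddCommGroup X] [NormedSpace ℝ X] [CompleteSpace X]
    (e : SchauderBasis ℝ X) (he_pre : IsPremonotoneBasis e) (he_unc : IsUnconditionalBasis e)
    (hX : ¬ ContainsEllOne X) :
    ¬ HasAffineFPP X ↔ ∃ x : ℕ → X, IsBasicSequence x ∧ ¬ IsBoundedlyComplete x := by
  constructor
  · intro h
    refine ⟨e, SchauderBasis.isBasicSequence e, fun hbc => h ?_⟩
    exact hasAffineFPP_of_weakly_convergent_subseq
      (he_unc.exists_weakly_convergent_subseq hX hbc)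
  · rintro ⟨x, hx, hxbc⟩
    refine he_pre.not_hasAffineFPP he_unc fun hbc => hxbc ?_
    exact hx.isBoundedlyComplete (he_unc.exists_weakly_convergent_subseq hX hbc)
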